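/- Let $d \ge 2$ and consider the lattice $\mathbb{Z}^d$, in which two vertices are joined by an edge when their $\ell^1$ distance is $1$. Let the edges $e$ carry real-valued passage times $t(e)$ that are random variables on a common probability space $(\Omega,\mathcal{F},\mathbb{P})$, independent and identically distributed with common law $F$, and suppose that (i) $\sup_{e} \mathbb{P}(t(e) < \epsilon) \to 0$ as $\epsilon \downarrow 0$; (ii) $\sup_{e} \mathbb{E}\, t(e)^2 < \infty$. For $n \ge 1$ let $T_n = \inf_{\pi} \sum_{e \in \pi} t(e)$, where the infimum is over all finite self-avoiding paths $\pi$ in $\mathbb{Z}^d$ with endvertices the origin and $(n,0,\ldots,0)$. Then there is a constant $\mu_F > 0$, depending only on $d$ and $F$, such that $$\frac{T_n}{n} \longrightarrow \mu_F \quad \text{almost surely and in } L^2 \text{ as } n \to \infty .$$ In particular, $T_n \in L^2$ for every $n$. -/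

import Mathlib

open MeasureTheory ProbabilityTheory Filter
open scoped Topology ENNReal

namespace FirstPassage

/-- The lattice `ℤ^d`: two vertices are adjacent when their `ℓ¹` distance is `1`. -/
def lattice (d : ℕ) : SimpleGraph (Fin d → ℤ) where
  Adj x y := ∑ i, |x i - y i| = 1
  symm := ⟨fun x y h => by simpa only [abs_sub_comm] using h⟩
  loopless := ⟨fun x h => by simp at h⟩

/-- The set of edges of `ℤ^d`. -/
abbrev Edge (d : ℕ) : Type := (lattice d).edgeSet

/-- The vertex `(n, 0, …, 0)` of `ℤ^d`. -/
def axisPoint (d : ℕ) (n : ℕ) : Fin d → ℤ := fun i => if i.val = 0 then (n : ℤ) else 0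

/-- The passage time `∑ τ(e)` of a walk, the sum being over its edges. -/
noncomputable def passageTime {d : ℕ} (τ : Edge d → ℝ) {x y : Fin d → ℤ}
    (p : (lattice d).Walk x y) : ℝ :=
  (p.edges.attach.map fun e => τ ⟨e.1, p.edges_subset_edgeSet e.2⟩).sum

/-- The minimum passage time `T_n` between the origin and `(n, 0, …, 0)`: the infimum of the passage
times of the finite self-avoiding paths between these two vertices. -/
noncomputable def minPassageTime {d : ℕ} (τ : Edge d → ℝ) (n : ℕ) : ℝ :=
  ⨅ p : (lattice d).Path 0 (axisPoint d n), passageTime τ p.1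

/-- `sup_e P(t(e) < ε) → 0` as `ε ↓ 0`. -/
def SmallTimesUnlikely {d : ℕ} {Ω : Type*} [MeasurableSpace Ω] (P : Measure Ω)
    (t : Edge d → Ω → ℝ) : Prop :=
  Tendsto (fun ε : ℝ => ⨆ e, P {ω | t e ω < ε}) (𝓝[>] 0) (𝓝 0)

/-- `sup_e E t(e)² < ∞`. -/
def BoundedSecondMoment {d : ℕ} {Ω : Type*} [MeasurableSpace Ω] (P : Measure Ω)
    (t : Edge d → Ω → ℝ) : Prop :=
  ⨆ e, ∫⁻ ω, ENNReal.ofReal (t e ω ^ 2) ∂P < ∞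

end FirstPassage

/-!
The minimum passage time `T_n` depends on each edge only if the edge lies on a minimizing path, so
the Efron–Stein inequality bounds its variance by a constant times the mean length of that path.
Since the edge times are almost surely positive, a Chernoff bound and the exponential growth of the
number of paths show that a path from the origin has length at most `r` times its passage time plus
an integrable excess which does not depend on the path; hence `Var T_n = O(n)`.

By subadditivity `E T_n / n` converges, and the limit is positive because the paths to
`(n, 0, …, 0)` have length at least `n`. The variance bound then gives convergence of `T_n / n` in
`L²`, and almost surely along the squares. Finally `T_n + S_n`, where `S_n` is the sum of the first
`n` times along the axis, is monotone in `n`, and `S_n / n` converges by the strong law of large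
numbers; monotonicity carries the almost sure convergence from the squares to all `n`.
-/

namespace FirstPassage

open scoped NNReal

section Involution

variable {Ω : Type*} [MeasurableSpace Ω] {Q : Measure Ω} {s : Ω ≃ᵐ Ω} {F H : Ω → ℝ}

theorem integral_mul_sub_comp_involutive_le (hs : MeasurePreserving s Q Q)
    (hinv : Function.Involutive s) (hF : MemLp F 2 Q) (hH : MemLp H 2 Q) :
    ∫ z, F z * (H z - H (s z)) ∂Q ≤
      4⁻¹ * ∫ z, (F z - F (s z)) ^ 2 ∂Q + 4⁻¹ * ∫ z, (H z - H (s z)) ^ 2 ∂Q := by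
  have hFs : MemLp (fun z => F (s z)) 2 Q := hF.comp_measurePreserving hs
  have hHs : MemLp (fun z => H (s z)) 2 Q := hH.comp_measurePreserving hs
  have hF2 : Integrable (fun z => 4⁻¹ * (F z - F (s z)) ^ 2) Q :=
    (hF.sub hFs).integrable_sq.const_mul _
  have hH2 : Integrable (fun z => 4⁻¹ * (H z - H (s z)) ^ 2) Q :=
    (hH.sub hHs).integrable_sq.const_mul _
  have hFH : Integrable (fun z => F z * (H z - H (s z))) Q := hF.integrable_mul (hH.sub hHs)
  have hFsH : Integrable (fun z => F (s z) * (H (s z) - H z)) Q :=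
    hFs.integrable_mul (hHs.sub hH)
  have hsymm : ∫ z, F (s z) * (H (s z) - H z) ∂Q = ∫ z, F z * (H z - H (s z)) ∂Q := by
    rw [← hs.integral_comp' fun z => F z * (H z - H (s z))]
    simp only [hinv _]
  calc ∫ z, F z * (H z - H (s z)) ∂Q
      = ∫ z, 2⁻¹ * (F z * (H z - H (s z)) + F (s z) * (H (s z) - H z)) ∂Q := by
        rw [integral_const_mul, integral_add hFH hFsH, hsymm]
        ring
    _ ≤ ∫ z, (4⁻¹ * (F z - F (s z)) ^ 2 + 4⁻¹ * (H z - H (s z)) ^ 2) ∂Q := by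
        refine integral_mono ((hFH.add hFsH).const_mul _) (hF2.add hH2) fun z => ?_
        dsimp only
        linarith [sq_nonneg ((F z - F (s z)) - (H z - H (s z)))]
    _ = _ := by
        rw [← integral_const_mul, ← integral_const_mul, ← integral_add hF2 hH2]

theorem integral_sq_sub_comp_involutive (hs : MeasurePreserving s Q Q)
    (hinv : Function.Involutive s) (hF : MemLp F 2 Q) :
    ∫ z, (F z - F (s z)) ^ 2 ∂Q = 2 * ∫ z, max (F (s z) - F z) 0 ^ 2 ∂Q := by
  have hFs : MemLp (fun z => F (s z)) 2 Q := hF.comp_measurePreserving hs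
  have hsymm : ∫ z, max (F z - F (s z)) 0 ^ 2 ∂Q = ∫ z, max (F (s z) - F z) 0 ^ 2 ∂Q := by
    rw [← hs.integral_comp' fun z => max (F z - F (s z)) 0 ^ 2]
    simp only [hinv _]
  have hsplit : ∀ z, (F z - F (s z)) ^ 2 =
      max (F z - F (s z)) 0 ^ 2 + max (F (s z) - F z) 0 ^ 2 := fun z => by
    rcases le_total (F z) (F (s z)) with h | h <;> simp [h, sub_sq_comm]
  simp only [hsplit]
  rw [two_mul, ← hsymm]
  nth_rw 2 [hsymm]
  exact integral_add (hF.sub hFs).pos_part.integrable_sq (hFs.sub hF).pos_part.integrable_sq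

end Involution

theorem variance_eq_integral_mul_sub_prod {Ω : Type*} [MeasurableSpace Ω] {P : Measure Ω}
    [IsProbabilityMeasure P] {f : Ω → ℝ} (hf : MemLp f 2 P) :
    Var[f; P] = ∫ z, f z.1 * (f z.1 - f z.2) ∂P.prod P := by
  have h1 : MemLp (fun z : Ω × Ω => f z.1) 2 (P.prod P) :=
    hf.comp_measurePreserving measurePreserving_fst
  have h2 : MemLp (fun z : Ω × Ω => f z.2) 2 (P.prod P) :=
    hf.comp_measurePreserving measurePreserving_snd
  have hsq : ∫ z, f z.1 ^ 2 ∂P.prod P = ∫ x, f x ^ 2 ∂P := by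
    simpa using integral_fun_fst (μ := P) (ν := P) fun x => f x ^ 2
  have hmul : Integrable (fun z : Ω × Ω => f z.1 * f z.2) (P.prod P) := h1.integrable_mul h2
  simp only [mul_sub, ← pow_two]
  rw [integral_sub h1.integrable_sq hmul, hsq, integral_prod_mul f f, variance_eq_sub hf, ← pow_two]
  rfl

section EfronStein

variable {ι : Type*} [DecidableEq ι] {X : ι → Type*} [∀ i, MeasurableSpace (X i)]

/-- The involution of pairs of configurations that exchanges their coordinates in `A`; it turns
the pair into one whose first member is resampled on `A`. -/
noncomputable def swapOn (A : Finset ι) : (∀ i, X i) × (∀ i, X i) ≃ᵐ (∀ i, X i) × (∀ i, X i) :=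
  MeasurableEquiv.ofInvolutive (fun z => (A.piecewise z.2 z.1, A.piecewise z.1 z.2))
    (fun z => by ext i <;> by_cases hi : i ∈ A <;> simp [hi])
    (by
      refine Measurable.prodMk (measurable_pi_lambda _ fun i => ?_)
          (measurable_pi_lambda _ fun i => ?_) <;>
        by_cases hi : i ∈ A <;> simp only [hi, Finset.piecewise_eq_of_mem,
          Finset.piecewise_eq_of_notMem, not_false_eq_true] <;> fun_prop)

theorem swapOn_apply (A : Finset ι) (z : (∀ i, X i) × (∀ i, X i)) :
    swapOn A z = (A.piecewise z.2 z.1, A.piecewise z.1 z.2) :=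
  rfl

theorem swapOn_involutive (A : Finset ι) : Function.Involutive (swapOn (X := X) A) :=
  (swapOn A).left_inv

theorem swapOn_swapOn_of_disjoint {A B : Finset ι} (h : Disjoint A B)
    (z : (∀ i, X i) × (∀ i, X i)) : swapOn A (swapOn B z) = swapOn (A ∪ B) z := by
  simp only [swapOn_apply]
  ext i <;> by_cases hA : i ∈ A
  · simp [hA, Finset.disjoint_left.1 h hA]
  · by_cases hB : i ∈ B <;> simp [hA, hB]
  · simp [hA, Finset.disjoint_left.1 h hA]
  · by_cases hB : i ∈ B <;> simp [hA, hB]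

variable {μ : ∀ i, Measure (X i)} [∀ i, IsProbabilityMeasure (μ i)]

theorem measurePreserving_swapOn (A : Finset ι) :
    MeasurePreserving (swapOn A) ((Measure.infinitePi μ).prod (Measure.infinitePi μ))
      ((Measure.infinitePi μ).prod (Measure.infinitePi μ)) := by
  let Y : (_ : Bool) × ι → Type _ := fun p => X p.2
  let ρ : Measure (∀ p, Y p) := Measure.infinitePi fun p => μ p.2
  let φ : (∀ p, Y p) → (∀ i, X i) × (∀ i, X i) := fun w =>
    (fun i => w ⟨true, i⟩, fun i => w ⟨false, i⟩)
  have hφm : Measurable φ := by fun_prop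
  have hφ : ρ.map φ = (Measure.infinitePi μ).prod (Measure.infinitePi μ) := by
    have h2 := Measure.infinitePi_map_eval_prod
      (P := fun _ : Bool => Measure.infinitePi μ) (i := true) (j := false) (by simp)
    rw [← h2, ← Measure.infinitePi_map_piCurry (fun (_ : Bool) i => μ i),
      Measure.map_map (by fun_prop) (by fun_prop)]
    rfl
  let g : (_ : Bool) × ι → (_ : Bool) × ι := fun p => ⟨if p.2 ∈ A then !p.1 else p.1, p.2⟩
  have hg : Function.Injective g := by
    rintro ⟨a, i⟩ ⟨b, j⟩ h
    simp only [g, Sigma.mk.injEq, heq_eq_eq] at h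
    obtain ⟨h, rfl⟩ := h
    split_ifs at h <;> simp_all
  have hρ : ρ.map (fun (w : ∀ p, Y p) p => (w (g p) : Y p)) = ρ :=
    Measure.map_infinitePi_infinitePi_of_inj (P := fun p : (_ : Bool) × ι => μ p.2) hg
  refine ⟨(swapOn A).measurable, ?_⟩
  rw [← hφ, Measure.map_map (swapOn A).measurable hφm]
  conv_rhs => rw [← hρ, Measure.map_map hφm (by fun_prop)]
  congr 1
  funext w
  have hw : ∀ {b b' : Bool} (i : ι), b = b' → (w ⟨b, i⟩ : X i) = w ⟨b', i⟩ := by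
    rintro b _ i rfl; rfl
  refine Prod.ext ?_ ?_ <;> funext i <;> by_cases hi : i ∈ A <;>
    simp only [swapOn_apply, φ, g, hi, Function.comp_apply, Finset.piecewise_eq_of_mem,
      Finset.piecewise_eq_of_notMem, not_false_eq_true] <;>
    exact hw i (by simp [hi])

theorem integral_mul_sub_swapOn_le {F : (∀ i, X i) × (∀ i, X i) → ℝ}
    (hF : MemLp F 2 ((Measure.infinitePi μ).prod (Measure.infinitePi μ))) (A : Finset ι) :
    ∫ z, F z * (F z - F (swapOn A z)) ∂(Measure.infinitePi μ).prod (Measure.infinitePi μ) ≤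
      ∑ e ∈ A, 2⁻¹ * ∫ z, (F z - F (swapOn {e} z)) ^ 2
        ∂(Measure.infinitePi μ).prod (Measure.infinitePi μ) := by
  set Q := (Measure.infinitePi μ).prod (Measure.infinitePi μ)
  have hswap : ∀ B : Finset ι, MemLp (fun z => F (swapOn B z)) 2 Q := fun B =>
    hF.comp_measurePreserving (measurePreserving_swapOn B)
  induction A using Finset.induction_on with
  | empty => simp [swapOn_apply]
  | insert e A he ih =>
    have hcomm : ∀ z : (∀ i, X i) × (∀ i, X i), swapOn {e} (swapOn A z) = swapOn A (swapOn {e} z) :=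
      fun z => by
        rw [swapOn_swapOn_of_disjoint (Finset.disjoint_singleton_left.2 he),
          swapOn_swapOn_of_disjoint (Finset.disjoint_singleton_right.2 he), Finset.union_comm]
    have hins : ∀ z : (∀ i, X i) × (∀ i, X i), swapOn (insert e A) z = swapOn A (swapOn {e} z) :=
      fun z => by
        rw [swapOn_swapOn_of_disjoint (Finset.disjoint_singleton_right.2 he), Finset.union_comm,
          Finset.insert_eq]
    have hshift : ∫ z, (F (swapOn A z) - F (swapOn A (swapOn {e} z))) ^ 2 ∂Q =
        ∫ z, (F z - F (swapOn {e} z)) ^ 2 ∂Q := by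
      simp only [← hcomm]
      exact (measurePreserving_swapOn A).integral_comp' fun z => (F z - F (swapOn {e} z)) ^ 2
    have hstep := integral_mul_sub_comp_involutive_le (measurePreserving_swapOn {e})
      (swapOn_involutive {e}) hF (hswap A)
    have hsplit : ∫ z, F z * (F z - F (swapOn (insert e A) z)) ∂Q =
        ∫ z, F z * (F z - F (swapOn A z)) ∂Q +
          ∫ z, F z * (F (swapOn A z) - F (swapOn A (swapOn {e} z))) ∂Q := by
      have hfst : Integrable (fun z => F z * (F z - F (swapOn A z))) Q :=
        hF.integrable_mul (hF.sub (hswap A))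
      have hsnd : Integrable (fun z => F z * (F (swapOn A z) - F (swapOn (insert e A) z))) Q :=
        hF.integrable_mul ((hswap A).sub (hswap _))
      simp only [← hins]
      rw [← integral_add hfst hsnd]
      congr 1 with z
      ring
    rw [Finset.sum_insert he, hsplit]
    linarith

theorem ofReal_half_integral_sq_sub_swapOn_singleton {f : (∀ i, X i) → ℝ} (hf : Measurable f)
    (hf2 : MemLp f 2 (Measure.infinitePi μ)) (e : ι) :
    ENNReal.ofReal (2⁻¹ * ∫ z, (f z.1 - f (swapOn {e} z).1) ^ 2
        ∂(Measure.infinitePi μ).prod (Measure.infinitePi μ)) =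
      ∫⁻ x, ∫⁻ y, ENNReal.ofReal (f (Function.update x e y) - f x) ^ 2
        ∂μ e ∂Measure.infinitePi μ := by
  have hF : MemLp (fun z => f z.1) 2 ((Measure.infinitePi μ).prod (Measure.infinitePi μ)) :=
    hf2.comp_measurePreserving measurePreserving_fst
  have hmeas : Measurable fun z : (∀ i, X i) × X e =>
      ENNReal.ofReal (f (Function.update z.1 e z.2) - f z.1) ^ 2 := by fun_prop
  have hswap : ∀ z : (∀ i, X i) × (∀ i, X i), (swapOn {e} z).1 = Function.update z.1 e (z.2 e) :=
    fun z => Finset.piecewise_singleton ..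
  have hint : Integrable (fun z => max (f (swapOn {e} z).1 - f z.1) 0 ^ 2)
      ((Measure.infinitePi μ).prod (Measure.infinitePi μ)) :=
    ((hF.comp_measurePreserving (measurePreserving_swapOn {e})).sub hF).pos_part.integrable_sq
  rw [integral_sq_sub_comp_involutive (measurePreserving_swapOn {e}) (swapOn_involutive {e}) hF,
    inv_mul_cancel_left₀ two_ne_zero,
    ofReal_integral_eq_lintegral_ofReal hint (ae_of_all _ fun z => sq_nonneg _)]
  simp only [hswap, ENNReal.ofReal_pow (le_max_right _ _), ENNReal.ofReal_max, ENNReal.ofReal_zero,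
    max_eq_left, zero_le]
  have heval : Measurable fun z : (∀ i, X i) × (∀ i, X i) => (z.1, z.2 e) := by fun_prop
  refine (lintegral_prod _ (hmeas.comp heval).aemeasurable).trans (lintegral_congr fun x => ?_)
  exact (measurePreserving_eval_infinitePi μ e).lintegral_comp (hmeas.comp measurable_prodMk_left)

/-- **Efron–Stein inequality**, one-sided. -/
theorem evariance_le_sum_lintegral_update {f : (∀ i, X i) → ℝ} (hf : Measurable f)
    (hf2 : MemLp f 2 (Measure.infinitePi μ)) {A : Finset ι} (hfA : DependsOn f (A : Set ι)) :
    eVar[f; Measure.infinitePi μ] ≤ ∑ e ∈ A, ∫⁻ x, ∫⁻ y,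
      ENNReal.ofReal (f (Function.update x e y) - f x) ^ 2 ∂μ e ∂Measure.infinitePi μ := by
  set P := Measure.infinitePi μ
  have hF : MemLp (fun z : (∀ i, X i) × (∀ i, X i) => f z.1) 2 (P.prod P) :=
    hf2.comp_measurePreserving measurePreserving_fst
  have hvar : Var[f; P] = ∫ z, f z.1 * (f z.1 - f (swapOn A z).1) ∂P.prod P := by
    rw [variance_eq_integral_mul_sub_prod hf2]
    congr 1 with z
    rw [hfA fun i hi => show z.2 i = (swapOn A z).1 i by simp_all [swapOn_apply]]
  rw [← ofReal_variance hf2, hvar]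
  refine (ENNReal.ofReal_le_ofReal (integral_mul_sub_swapOn_le hF A)).trans_eq ?_
  rw [ENNReal.ofReal_sum_of_nonneg fun e _ => by positivity]
  exact Finset.sum_congr rfl fun e _ => ofReal_half_integral_sq_sub_swapOn_singleton hf hf2 e

end EfronStein

section VarianceConvergence

variable {Ω : Type*} [MeasurableSpace Ω] {P : Measure Ω}

theorem eLpNorm_sub_const_le_evariance [IsProbabilityMeasure P] {Y : Ω → ℝ}
    (hY : AEMeasurable Y P) (a : ℝ) :
    eLpNorm (fun ω => Y ω - a) 2 P ≤ eVar[Y; P] ^ (2⁻¹ : ℝ) + ‖P[Y] - a‖ₑ := by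
  have hvar : eLpNorm (fun ω => Y ω - P[Y]) 2 P = eVar[Y; P] ^ (2⁻¹ : ℝ) := by
    simp [eLpNorm_eq_lintegral_rpow_enorm_toReal two_ne_zero ENNReal.ofNat_ne_top, evariance]
  have hconst : eLpNorm (fun _ : Ω => P[Y] - a) 2 P = ‖P[Y] - a‖ₑ := by
    simp [eLpNorm_const _ two_ne_zero (NeZero.ne P)]
  rw [← hvar, ← hconst]
  refine Eq.trans_le ?_ (eLpNorm_add_le (hY.sub_const P[Y]).aestronglyMeasurable
    aestronglyMeasurable_const one_le_two)
  simp [Pi.add_def]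

theorem tendsto_eLpNorm_sub_of_tendsto_evariance [IsProbabilityMeasure P] {α : Type*}
    {l : Filter α} {Y : α → Ω → ℝ} {a : ℝ} (hY : ∀ i, AEMeasurable (Y i) P)
    (hmean : Tendsto (fun i => P[Y i]) l (𝓝 a)) (hvar : Tendsto (fun i => eVar[Y i; P]) l (𝓝 0)) :
    Tendsto (fun i => eLpNorm (fun ω => Y i ω - a) 2 P) l (𝓝 0) := by
  have hsqrt : Tendsto (fun i => eVar[Y i; P] ^ (2⁻¹ : ℝ)) l (𝓝 0) := by
    simpa using hvar.ennrpow_const 2⁻¹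
  have hbias : Tendsto (fun i => ‖P[Y i] - a‖ₑ) l (𝓝 0) := by
    simpa using (hmean.sub_const a).enorm
  refine tendsto_of_tendsto_of_tendsto_of_le_of_le tendsto_const_nhds
    (by simpa using hsqrt.add hbias) (fun _ => zero_le) fun i => ?_
  exact eLpNorm_sub_const_le_evariance (hY i) a

theorem ae_tendsto_of_tsum_evariance_ne_top {Y : ℕ → Ω → ℝ} {a : ℝ}
    (hY : ∀ k, AEMeasurable (Y k) P) (hmean : Tendsto (fun k => P[Y k]) atTop (𝓝 a))
    (hvar : ∑' k, eVar[Y k; P] ≠ ∞) :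
    ∀ᵐ ω ∂P, Tendsto (fun k => Y k ω) atTop (𝓝 a) := by
  have hmeas : ∀ k, AEMeasurable (fun ω => ‖Y k ω - P[Y k]‖ₑ ^ 2) P := fun k =>
    ((hY k).sub_const _).enorm.pow_const 2
  have hsum : ∫⁻ ω, ∑' k, ‖Y k ω - P[Y k]‖ₑ ^ 2 ∂P ≠ ∞ := by
    rwa [lintegral_tsum hmeas]
  filter_upwards [ae_lt_top' (AEMeasurable.tsum hmeas) hsum] with ω hω
  have hsq : Tendsto (fun k => ‖Y k ω - P[Y k]‖ₑ) atTop (𝓝 0) := by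
    have h := (ENNReal.tendsto_atTop_zero_of_tsum_ne_top hω.ne).ennrpow_const 2⁻¹
    have hroot : ∀ x : ℝ≥0∞, (x ^ 2) ^ (2⁻¹ : ℝ) = x := ENNReal.pow_rpow_inv_natCast two_ne_zero
    simpa only [hroot, ENNReal.zero_rpow_of_pos (inv_pos.2 two_pos)] using h
  simpa using (tendsto_zero_iff_enorm_tendsto_zero.2 hsq).add hmean

theorem tendsto_div_of_monotone_add_of_tendsto_div_sq {T S : ℕ → ℝ} {a m : ℝ}
    (hmono : Monotone fun n => T n + S n) (hS : Tendsto (fun n : ℕ => S n / n) atTop (𝓝 m))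
    (hT : Tendsto (fun k : ℕ => T ((k + 1) ^ 2) / ((k + 1) ^ 2 : ℕ)) atTop (𝓝 a)) :
    Tendsto (fun n : ℕ => T n / n) atTop (𝓝 a) := by
  have hsq : Tendsto (fun k : ℕ => (k + 1) ^ 2) atTop atTop :=
    (tendsto_pow_atTop two_ne_zero).comp (tendsto_add_atTop_nat 1)
  have hratio : ∀ b : ℝ, 1 < b →
      ∀ᶠ k : ℕ in atTop, (((k + 1 + 1) ^ 2 : ℕ) : ℝ) ≤ b * ((k + 1) ^ 2 : ℕ) := fun b hb => by
    have hlim : Tendsto (fun k : ℕ => (1 + 1 / ((k : ℝ) + 1)) ^ 2) atTop (𝓝 1) := by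
      simpa using (tendsto_one_div_add_atTop_nhds_zero_nat (𝕜 := ℝ)).const_add 1 |>.pow 2
    filter_upwards [hlim.eventually_le_const hb] with k hk
    calc (((k + 1 + 1) ^ 2 : ℕ) : ℝ) = (1 + 1 / ((k : ℝ) + 1)) ^ 2 * ((k + 1) ^ 2 : ℕ) := by
          push_cast; field_simp
      _ ≤ b * ((k + 1) ^ 2 : ℕ) := by gcongr
  have hsum := tendsto_div_of_monotone_of_exists_subseq_tendsto_div _ (a + m) hmono fun b hb =>
    ⟨_, hratio b hb, hsq, by simpa only [add_div] using! hT.add (hS.comp hsq)⟩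
  simpa [add_div] using hsum.sub hS

end VarianceConvergence

section LinearVariance

variable {Ω : Type*} [MeasurableSpace Ω] {P : Measure Ω} {T : ℕ → Ω → ℝ} {C : ℝ≥0∞} {a : ℝ}

theorem evariance_div_natCast_le {X : Ω → ℝ} {n : ℕ} (hX : eVar[X; P] ≤ C * n) :
    eVar[fun ω => X ω / n; P] ≤ C * (n : ℝ≥0∞)⁻¹ := by
  rcases n.eq_zero_or_pos with rfl | hn
  · simp [evariance]
  have hn0 : (n : ℝ≥0∞) ≠ 0 := by exact_mod_cast hn.ne'
  have hcoe : ENNReal.ofReal ((n : ℝ)⁻¹ ^ 2) = (n : ℝ≥0∞)⁻¹ ^ 2 := by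
    rw [ENNReal.ofReal_pow (by positivity), ENNReal.ofReal_inv_of_pos (by positivity),
      ENNReal.ofReal_natCast]
  simp only [div_eq_inv_mul, evariance_mul, hcoe]
  calc (n : ℝ≥0∞)⁻¹ ^ 2 * eVar[X; P] ≤ (n : ℝ≥0∞)⁻¹ ^ 2 * (C * n) := by gcongr
    _ = C * (n : ℝ≥0∞)⁻¹ * ((n : ℝ≥0∞)⁻¹ * n) := by ring
    _ = C * (n : ℝ≥0∞)⁻¹ := by
      rw [ENNReal.inv_mul_cancel hn0 (ENNReal.natCast_ne_top n), mul_one]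

theorem tendsto_eLpNorm_div_sub_of_evariance_le [IsProbabilityMeasure P]
    (hT : ∀ n, AEMeasurable (T n) P)
    (hmean : Tendsto (fun n : ℕ => P[T n] / (n : ℝ)) atTop (𝓝 a)) (hC : C ≠ ∞)
    (hvar : ∀ n, eVar[T n; P] ≤ C * n) :
    Tendsto (fun n : ℕ => eLpNorm (fun ω => T n ω / n - a) 2 P) atTop (𝓝 0) := by
  refine tendsto_eLpNorm_sub_of_tendsto_evariance (fun n => (hT n).div_const n)
    (by simpa only [integral_div] using hmean) ?_
  refine tendsto_of_tendsto_of_tendsto_of_le_of_le tendsto_const_nhds ?_ (fun _ => zero_le)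
    fun n => evariance_div_natCast_le (hvar n)
  simpa using ENNReal.Tendsto.const_mul ENNReal.tendsto_inv_nat_nhds_zero (Or.inr hC)

theorem ae_tendsto_div_sq_of_evariance_le (hT : ∀ n, AEMeasurable (T n) P)
    (hmean : Tendsto (fun n : ℕ => P[T n] / (n : ℝ)) atTop (𝓝 a)) (hC : C ≠ ∞)
    (hvar : ∀ n, eVar[T n; P] ≤ C * n) :
    ∀ᵐ ω ∂P, Tendsto (fun k : ℕ => T ((k + 1) ^ 2) ω / ((k + 1) ^ 2 : ℕ)) atTop (𝓝 a) := by
  have hsq : Tendsto (fun k : ℕ => (k + 1) ^ 2) atTop atTop :=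
    (tendsto_pow_atTop two_ne_zero).comp (tendsto_add_atTop_nat 1)
  refine ae_tendsto_of_tsum_evariance_ne_top (fun k => (hT _).div_const _)
    (by simpa only [integral_div] using! hmean.comp hsq) ?_
  have hbasel : ∑' k : ℕ, (((k + 1) ^ 2 : ℕ) : ℝ≥0∞)⁻¹ ≠ ∞ := by
    have h : Summable fun k : ℕ => (((k + 1 : ℕ) : ℝ) ^ 2)⁻¹ :=
      (summable_nat_add_iff 1).2 (Real.summable_nat_pow_inv.2 one_lt_two)
    convert h.tsum_ofReal_ne_top with k
    rw [ENNReal.ofReal_inv_of_pos (by positivity), ← Nat.cast_pow, ENNReal.ofReal_natCast]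
  refine ne_top_of_le_ne_top (ENNReal.mul_ne_top hC hbasel) ?_
  rw [← ENNReal.tsum_mul_left]
  exact ENNReal.tsum_le_tsum fun k => evariance_div_natCast_le (hvar _)

theorem ae_tendsto_div_of_evariance_le {S : ℕ → Ω → ℝ} {m : ℝ} (hT : ∀ n, AEMeasurable (T n) P)
    (hmean : Tendsto (fun n : ℕ => P[T n] / (n : ℝ)) atTop (𝓝 a)) (hC : C ≠ ∞)
    (hvar : ∀ n, eVar[T n; P] ≤ C * n) (hmono : ∀ ω, Monotone fun n => T n ω + S n ω)
    (hS : ∀ᵐ ω ∂P, Tendsto (fun n : ℕ => S n ω / n) atTop (𝓝 m)) :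
    ∀ᵐ ω ∂P, Tendsto (fun n : ℕ => T n ω / n) atTop (𝓝 a) := by
  filter_upwards [ae_tendsto_div_sq_of_evariance_le hT hmean hC hvar, hS] with ω hTω hSω
  exact tendsto_div_of_monotone_add_of_tendsto_div_sq (hmono ω) hSω hTω

end LinearVariance

section MinSum

variable {ι κ κ' : Type*} {A : κ → Finset ι} {r : ℝ≥0} {τ : ι → ℝ≥0}

/-- The least total weight of a set of the family `A`, for the weights `τ`. The passage time between
two vertices of a graph is the case where `A` lists the edge sets of the paths between them. Since
the values are nonnegative, the infimum is `0` when the family is empty. -/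
noncomputable def minSum (A : κ → Finset ι) (τ : ι → ℝ≥0) : ℝ≥0 :=
  ⨅ k, ∑ e ∈ A k, τ e

/-- The largest amount by which the cardinality of a set of the family `A` exceeds `r` times its
weight; its integrability says that light sets are small. The subtraction truncates at `0`. -/
noncomputable def excess (A : κ → Finset ι) (r : ℝ≥0) (τ : ι → ℝ≥0) : ℝ≥0∞ :=
  ⨆ k, (((A k).card : ℝ≥0∞) - (r * ∑ e ∈ A k, τ e : ℝ≥0))

theorem minSum_le (A : κ → Finset ι) (τ : ι → ℝ≥0) (k : κ) : minSum A τ ≤ ∑ e ∈ A k, τ e :=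
  ciInf_le (OrderBot.bddBelow _) k

theorem minSum_le_minSum_comp [Nonempty κ'] (f : κ' → κ) : minSum A τ ≤ minSum (A ∘ f) τ :=
  le_ciInf fun k => minSum_le A τ (f k)

theorem excess_comp_le (f : κ' → κ) : excess (A ∘ f) r τ ≤ excess A r τ :=
  iSup_comp_le (fun k => ((A k).card : ℝ≥0∞) - (r * ∑ e ∈ A k, τ e : ℝ≥0)) f

theorem card_le_mul_sum_add_excess (A : κ → Finset ι) (r : ℝ≥0) (τ : ι → ℝ≥0) (k : κ) :
    ((A k).card : ℝ≥0∞) ≤ (r * ∑ e ∈ A k, τ e : ℝ≥0) + excess A r τ :=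
  tsub_le_iff_left.1 (le_iSup (fun k => ((A k).card : ℝ≥0∞) - (r * ∑ e ∈ A k, τ e : ℝ≥0)) k)

theorem natCast_le_mul_minSum_add_excess [Nonempty κ] {n : ℕ} (hn : ∀ k, n ≤ (A k).card) :
    (n : ℝ≥0∞) ≤ r * minSum A τ + excess A r τ := by
  rw [← tsub_le_iff_right, minSum, ← ENNReal.coe_mul, NNReal.mul_iInf, ENNReal.coe_iInf]
  refine le_iInf fun k => tsub_le_iff_right.2 ?_
  exact (Nat.cast_le.2 (hn k)).trans (card_le_mul_sum_add_excess A r τ k)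

theorem minSum_update_le [DecidableEq ι] {k : κ} (hk : ∑ e ∈ A k, τ e = minSum A τ) (e : ι)
    (t : ℝ≥0) :
    minSum A (Function.update τ e t) ≤ minSum A τ + if e ∈ A k then t else 0 := by
  refine (minSum_le A _ k).trans ?_
  rw [← hk]
  split_ifs with he
  · rw [Finset.sum_update_of_mem he, add_comm]
    gcongr
    exact Finset.sdiff_subset
  · rw [Finset.sum_update_of_notMem he, add_zero]

theorem dependsOn_minSum [Fintype κ] [DecidableEq ι] (A : κ → Finset ι) :
    DependsOn (minSum A) (Finset.univ.biUnion A : Set ι) := fun _ _ h =>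
  iInf_congr fun k => Finset.sum_congr rfl fun e he =>
    h e (Finset.mem_biUnion.2 ⟨k, Finset.mem_univ k, he⟩)

@[fun_prop]
theorem measurable_minSum [Countable κ] (A : κ → Finset ι) : Measurable (minSum A) :=
  Measurable.iInf fun k => by fun_prop

@[fun_prop]
theorem measurable_excess [Countable κ] (A : κ → Finset ι) (r : ℝ≥0) :
    Measurable (excess A r) :=
  Measurable.iSup fun k => by fun_prop

theorem tendsto_minSum_comp_fin {f : ℕ → κ} (hf : Function.Surjective f) (τ : ι → ℝ≥0) :
    Tendsto (fun N => minSum (A ∘ fun i : Fin (N + 1) => f i) τ) atTop (𝓝 (minSum A τ)) := by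
  have : Nonempty κ := ⟨f 0⟩
  refine tendsto_order.2 ⟨fun a ha => ?_, fun a ha => ?_⟩
  · exact Eventually.of_forall fun N => ha.trans_le (minSum_le_minSum_comp _)
  · obtain ⟨k, hk⟩ := exists_lt_of_ciInf_lt ha
    obtain ⟨i, rfl⟩ := hf k
    filter_upwards [eventually_ge_atTop i] with N hN
    exact (minSum_le _ τ (⟨i, Nat.lt_succ_of_le hN⟩ : Fin (N + 1))).trans_lt hk

end MinSum

theorem evariance_le_of_tendsto {Ω : Type*} [MeasurableSpace Ω] {P : Measure Ω}
    {Y : ℕ → Ω → ℝ} {Z : Ω → ℝ} {b : ℕ → ℝ≥0∞} {c : ℝ≥0∞} (hY : ∀ n, AEMeasurable (Y n) P)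
    (hlim : ∀ᵐ ω ∂P, Tendsto (fun n => Y n ω) atTop (𝓝 (Z ω)))
    (hmean : Tendsto (fun n => P[Y n]) atTop (𝓝 P[Z])) (hb : ∀ n, eVar[Y n; P] ≤ b n)
    (hbc : Tendsto b atTop (𝓝 c)) : eVar[Z; P] ≤ c := by
  calc eVar[Z; P] = ∫⁻ ω, liminf (fun n => ‖Y n ω - P[Y n]‖ₑ ^ 2) atTop ∂P := by
        refine lintegral_congr_ae (hlim.mono fun ω hω => ?_)
        exact (((ENNReal.continuous_pow 2).tendsto _).comp (hω.sub hmean).enorm).liminf_eq.symm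
    _ ≤ liminf (fun n => eVar[Y n; P]) atTop :=
        lintegral_liminf_le' fun n => ((hY n).sub_const _).enorm.pow_const 2
    _ ≤ liminf b atTop := liminf_le_liminf (Eventually.of_forall hb)
    _ = c := hbc.liminf_eq

section RandomMinSum

variable {ι κ : Type*} {A : κ → Finset ι} {r : ℝ≥0} {μ : ι → Measure ℝ≥0}
  [∀ e, IsProbabilityMeasure (μ e)]

theorem memLp_minSum [Countable κ] [Nonempty κ] {p : ℝ≥0∞}
    (hμ : ∀ e, MemLp (fun t : ℝ≥0 => (t : ℝ)) p (μ e)) (A : κ → Finset ι) :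
    MemLp (fun τ => (minSum A τ : ℝ)) p (Measure.infinitePi μ) := by
  obtain ⟨k⟩ := ‹Nonempty κ›
  have hsum : MemLp (fun τ : ι → ℝ≥0 => ∑ e ∈ A k, (τ e : ℝ)) p (Measure.infinitePi μ) :=
    memLp_finsetSum _ fun e _ =>
      (hμ e).comp_measurePreserving (measurePreserving_eval_infinitePi μ e)
  refine hsum.mono (measurable_minSum A).coe_nnreal_real.aestronglyMeasurable
    (ae_of_all _ fun τ => ?_)
  rw [← NNReal.coe_sum]
  rw [Real.norm_of_nonneg (NNReal.coe_nonneg _)]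
  exact (NNReal.coe_le_coe.2 (minSum_le A τ k)).trans (le_abs_self _)

theorem lintegral_ofReal_minSum_update_sub_sq_le [DecidableEq ι] {M : ℝ≥0∞}
    (hM : ∀ e, ∫⁻ t, (t : ℝ≥0∞) ^ 2 ∂μ e ≤ M) {τ : ι → ℝ≥0} {k : κ}
    (hk : ∑ e ∈ A k, τ e = minSum A τ) (e : ι) :
    ∫⁻ t, ENNReal.ofReal (minSum A (Function.update τ e t) - minSum A τ) ^ 2 ∂μ e ≤
      if e ∈ A k then M else 0 := by
  have hpt : ∀ t, ENNReal.ofReal (minSum A (Function.update τ e t) - minSum A τ) ≤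
      if e ∈ A k then (t : ℝ≥0∞) else 0 := fun t => by
    have h : (minSum A (Function.update τ e t) : ℝ) ≤ minSum A τ + if e ∈ A k then t else 0 :=
      NNReal.coe_le_coe.2 (minSum_update_le hk e t)
    split_ifs at h ⊢ <;> simp_all [ENNReal.ofReal_le_iff_le_toReal, add_comm]
  calc _ ≤ ∫⁻ t, (if e ∈ A k then (t : ℝ≥0∞) else 0) ^ 2 ∂μ e := by gcongr; exact hpt _
    _ ≤ _ := by split_ifs <;> simp [hM]

theorem evariance_minSum_le_of_finite [Finite κ] [Nonempty κ]
    (hμ : ∀ e, MemLp (fun t : ℝ≥0 => (t : ℝ)) 2 (μ e)) {M : ℝ≥0∞}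
    (hM : ∀ e, ∫⁻ t, (t : ℝ≥0∞) ^ 2 ∂μ e ≤ M) :
    eVar[fun τ => (minSum A τ : ℝ); Measure.infinitePi μ] ≤
      M * ∫⁻ τ, (r * minSum A τ + excess A r τ) ∂Measure.infinitePi μ := by
  classical
  have := Fintype.ofFinite κ
  have hmeas := measurable_minSum A
  have hdep : DependsOn (fun τ => (minSum A τ : ℝ)) (Finset.univ.biUnion A : Set ι) :=
    fun _ _ h => congrArg _ (dependsOn_minSum A h)
  refine (evariance_le_sum_lintegral_update hmeas.coe_nnreal_real (memLp_minSum hμ A) hdep).trans ?_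
  rw [← lintegral_finsetSum _ fun e _ => Measurable.lintegral_prod_right' (f := fun z =>
      ENNReal.ofReal (minSum A (Function.update z.1 e z.2) - minSum A z.1) ^ 2) (by fun_prop),
    ← lintegral_const_mul _ (by fun_prop)]
  refine lintegral_mono fun τ => ?_
  obtain ⟨k, hk⟩ := exists_eq_ciInf_of_finite (f := fun k => ∑ e ∈ A k, τ e)
  calc _ ≤ ∑ e ∈ Finset.univ.biUnion A, if e ∈ A k then M else 0 :=
        Finset.sum_le_sum fun e _ => lintegral_ofReal_minSum_update_sub_sq_le hM hk e
    _ = M * (A k).card := by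
        rw [Finset.sum_ite_mem, Finset.sum_const, nsmul_eq_mul, mul_comm,
          Finset.inter_eq_right.2 (Finset.subset_biUnion_of_mem A (Finset.mem_univ k))]
    _ ≤ M * (r * minSum A τ + excess A r τ) := by
        gcongr
        rw [minSum, ← hk]
        exact_mod_cast card_le_mul_sum_add_excess A r τ k

theorem lintegral_minSum_ne_top [Countable κ] [Nonempty κ]
    (hμ : ∀ e, MemLp (fun t : ℝ≥0 => (t : ℝ)) 1 (μ e)) (A : κ → Finset ι) :
    ∫⁻ τ, minSum A τ ∂Measure.infinitePi μ ≠ ∞ := by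
  simpa [enorm_eq_nnnorm] using! ((memLp_minSum hμ A).integrable le_rfl).lintegral_lt_top.ne

theorem tendsto_lintegral_minSum_comp_fin
    (hμ : ∀ e, MemLp (fun t : ℝ≥0 => (t : ℝ)) 1 (μ e)) {f : ℕ → κ} (hf : Function.Surjective f) :
    Tendsto (fun N => ∫⁻ τ, minSum (A ∘ fun i : Fin (N + 1) => f i) τ ∂Measure.infinitePi μ) atTop
      (𝓝 (∫⁻ τ, minSum A τ ∂Measure.infinitePi μ)) := by
  refine tendsto_lintegral_of_dominated_convergence _ (fun N => by fun_prop)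
    (fun N => ae_of_all _ fun τ => ?_)
    (lintegral_minSum_ne_top hμ (A ∘ fun i : Fin (0 + 1) => f i))
    (ae_of_all _ fun τ => ENNReal.tendsto_coe.2 (tendsto_minSum_comp_fin hf τ))
  exact ENNReal.coe_le_coe.2 (minSum_le_minSum_comp (Fin.castLE (Nat.le_add_left _ _)))

theorem evariance_minSum_le [Countable κ] [Nonempty κ]
    (hμ : ∀ e, MemLp (fun t : ℝ≥0 => (t : ℝ)) 2 (μ e)) {M : ℝ≥0}
    (hM : ∀ e, ∫⁻ t, (t : ℝ≥0∞) ^ 2 ∂μ e ≤ M) :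
    eVar[fun τ => (minSum A τ : ℝ); Measure.infinitePi μ] ≤
      M * (r * ∫⁻ τ, minSum A τ ∂Measure.infinitePi μ +
        ∫⁻ τ, excess A r τ ∂Measure.infinitePi μ) := by
  obtain ⟨f, hf⟩ := exists_surjective_nat κ
  have hμ1 : ∀ e, MemLp (fun t : ℝ≥0 => (t : ℝ)) 1 (μ e) := fun e => (hμ e).mono_exponent one_le_two
  have hlim := tendsto_lintegral_minSum_comp_fin (A := A) hμ1 hf
  refine evariance_le_of_tendsto (Y := fun N τ => minSum (A ∘ fun i : Fin (N + 1) => f i) τ)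
    (b := fun N => M * (r * ∫⁻ τ, minSum (A ∘ fun i : Fin (N + 1) => f i) τ
      ∂Measure.infinitePi μ + ∫⁻ τ, excess A r τ ∂Measure.infinitePi μ))
    (fun N => (measurable_minSum _).coe_nnreal_real.aemeasurable)
    (ae_of_all _ fun τ => NNReal.tendsto_coe.2 (tendsto_minSum_comp_fin hf τ)) ?_ (fun N => ?_) ?_
  · simp_rw [← ENNReal.coe_toReal]
    simp_rw [integral_toReal (measurable_minSum _).coe_nnreal_ennreal.aemeasurable (by simp)]
    exact (ENNReal.tendsto_toReal (lintegral_minSum_ne_top hμ1 A)).comp hlim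
  · refine (evariance_minSum_le_of_finite (r := r) hμ hM).trans ?_
    gcongr
    rw [lintegral_add_right _ (measurable_excess _ _),
      lintegral_const_mul _ (measurable_minSum _).coe_nnreal_ennreal]
    gcongr
    exact excess_comp_le _
  · exact ENNReal.Tendsto.const_mul ((ENNReal.Tendsto.const_mul hlim (by simp)).add_const _)
      (by simp)

end RandomMinSum

section Chernoff

variable {ι κ : Type*} {A : κ → Finset ι} {r : ℝ≥0} {D : ℕ}

theorem excess_le_tsum_prod_exp (A : κ → Finset ι) (r : ℝ≥0) (τ : ι → ℝ≥0) :
    excess A r τ ≤ ∑' k, ∏ e ∈ A k, ENNReal.ofReal (Real.exp (1 - r * τ e)) := by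
  refine iSup_le fun k => le_trans ?_ (ENNReal.le_tsum k)
  calc ((A k).card : ℝ≥0∞) - (r * ∑ e ∈ A k, τ e : ℝ≥0)
      = ENNReal.ofReal (∑ e ∈ A k, (1 - r * τ e : ℝ)) := by
        rw [Finset.sum_sub_distrib, ← Finset.mul_sum, ENNReal.ofReal_sub _ (by positivity)]
        simp [← NNReal.coe_sum, ← NNReal.coe_mul]
    _ ≤ ENNReal.ofReal (Real.exp (∑ e ∈ A k, (1 - r * τ e : ℝ))) :=
        ENNReal.ofReal_le_ofReal (by linarith [Real.add_one_le_exp (∑ e ∈ A k, (1 - r * τ e : ℝ))])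
    _ = ∏ e ∈ A k, ENNReal.ofReal (Real.exp (1 - r * τ e)) := by
        rw [Real.exp_sum, ENNReal.ofReal_prod_of_nonneg fun _ _ => (Real.exp_pos _).le]

theorem lintegral_prod_comp_infinitePi {X : ι → Type*} [∀ i, MeasurableSpace (X i)]
    (μ : ∀ i, Measure (X i)) [∀ i, IsProbabilityMeasure (μ i)] {g : ∀ i, X i → ℝ≥0∞}
    (hg : ∀ i, Measurable (g i)) (s : Finset ι) :
    ∫⁻ x, ∏ i ∈ s, g i (x i) ∂Measure.infinitePi μ = ∏ i ∈ s, ∫⁻ t, g i t ∂μ i := by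
  rw [lintegral_prod_eq_prod_lintegral_of_indepFun s _ (iIndepFun_infinitePi fun i => hg i)
    fun i => (hg i).comp (measurable_pi_apply i)]
  exact Finset.prod_congr rfl fun i _ =>
    (measurePreserving_eval_infinitePi μ i).lintegral_comp (hg i)

theorem tsum_pow_le_tsum_geometric {c : κ → ℕ}
    (hc : ∀ n, ENat.card {k // c k = n} ≤ (D : ℕ∞) ^ n) (x : ℝ≥0∞) :
    ∑' k, x ^ c k ≤ ∑' n : ℕ, (D * x) ^ n := by
  rw [← (Equiv.sigmaFiberEquiv c).tsum_eq, ENNReal.tsum_sigma']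
  refine ENNReal.tsum_le_tsum fun n => ?_
  calc ∑' k : {k // c k = n}, x ^ c k = ENat.card {k // c k = n} * x ^ n := by
        rw [← ENNReal.tsum_const]
        exact tsum_congr fun k => by rw [k.2]
    _ ≤ (D * x) ^ n := by
        rw [mul_pow]
        gcongr
        exact_mod_cast ENat.toENNReal_le.2 (hc n)

theorem tendsto_lintegral_exp_sub_mul {G : Measure ℝ≥0} [IsFiniteMeasure G] (hG : G {0} = 0) :
    Tendsto (fun r : ℝ≥0 => ∫⁻ t, ENNReal.ofReal (Real.exp (1 - r * t)) ∂G) atTop (𝓝 0) := by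
  rw [← lintegral_zero (μ := G)]
  refine tendsto_lintegral_filter_of_dominated_convergence (fun _ => ENNReal.ofReal (Real.exp 1))
    (Eventually.of_forall fun r => by fun_prop)
    (Eventually.of_forall fun r => ae_of_all _ fun t => ?_)
    (by simp [ENNReal.mul_ne_top]) ?_
  · gcongr
    linarith [show (0 : ℝ) ≤ r * t by positivity]
  · filter_upwards [measure_eq_zero_iff_ae_notMem.1 hG] with t ht
    have ht : (0 : ℝ) < t := NNReal.coe_pos.2 (pos_iff_ne_zero.2 ht)
    rw [← ENNReal.ofReal_zero]
    refine ENNReal.tendsto_ofReal (Real.tendsto_exp_atBot.comp ?_)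
    exact tendsto_atBot_add_const_left _ _ (tendsto_neg_atTop_atBot.comp
      (NNReal.tendsto_coe_atTop.2 tendsto_id |>.atTop_mul_const ht))

theorem exists_lintegral_excess_ne_top [Countable κ] {G : Measure ℝ≥0} [IsProbabilityMeasure G]
    (hG : G {0} = 0) (hA : ∀ n, ENat.card {k // (A k).card = n} ≤ (D : ℕ∞) ^ n) :
    ∃ r, ∫⁻ τ, excess A r τ ∂Measure.infinitePi (fun _ => G) ≠ ∞ := by
  have hlim : Tendsto (fun r : ℝ≥0 => D * ∫⁻ t, ENNReal.ofReal (Real.exp (1 - r * t)) ∂G)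
      atTop (𝓝 0) := by
    simpa using ENNReal.Tendsto.const_mul (tendsto_lintegral_exp_sub_mul hG) (by simp)
  obtain ⟨r, hr⟩ := (hlim.eventually_lt_const one_pos).exists
  refine ⟨r, ne_top_of_le_ne_top ?_ (calc
    ∫⁻ τ, excess A r τ ∂Measure.infinitePi (fun _ => G)
      ≤ ∫⁻ τ, ∑' k, ∏ e ∈ A k, ENNReal.ofReal (Real.exp (1 - r * τ e))
          ∂Measure.infinitePi (fun _ => G) := lintegral_mono (excess_le_tsum_prod_exp A r)
    _ = ∑' k, (∫⁻ t, ENNReal.ofReal (Real.exp (1 - r * t)) ∂G) ^ (A k).card := by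
        rw [lintegral_tsum fun k => Measurable.aemeasurable (by fun_prop)]
        refine tsum_congr fun k => ?_
        rw [lintegral_prod_comp_infinitePi (fun _ => G)
          (g := fun _ t => ENNReal.ofReal (Real.exp (1 - r * t))) (fun _ => by fun_prop),
          Finset.prod_const]
    _ ≤ _ := tsum_pow_le_tsum_geometric hA _)⟩
  rw [ENNReal.tsum_geometric]
  exact ENNReal.inv_ne_top.2 (tsub_pos_of_lt hr).ne'

end Chernoff

section PassageDist

variable {V : Type*} {G : SimpleGraph V} {x y z : V} {τ : G.edgeSet → ℝ≥0}

open Classical in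
/-- The set of edges of a walk, as a set of edges of the graph. -/
noncomputable def walkEdges (p : G.Walk x y) : Finset G.edgeSet :=
  (p.edges.attach.map fun e => ⟨e.1, p.edges_subset_edgeSet e.2⟩).toFinset

theorem mem_walkEdges {p : G.Walk x y} {e : G.edgeSet} : e ∈ walkEdges p ↔ e.1 ∈ p.edges := by
  simp [walkEdges, Subtype.ext_iff]

theorem nodup_attach_map_edges {p : G.Walk x y} (hp : p.IsPath) :
    (p.edges.attach.map fun e => (⟨e.1, p.edges_subset_edgeSet e.2⟩ : G.edgeSet)).Nodup :=
  (List.nodup_attach.2 hp.isTrail.edges_nodup).map fun _ _ h =>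
    Subtype.ext (Subtype.mk.inj h)

theorem sum_walkEdges {M : Type*} [AddCommMonoid M] (p : G.Path x y) (f : G.edgeSet → M) :
    ∑ e ∈ walkEdges p.1, f e =
      (p.1.edges.attach.map fun e => f ⟨e.1, p.1.edges_subset_edgeSet e.2⟩).sum := by
  classical
  rw [walkEdges, List.sum_toFinset f (nodup_attach_map_edges p.2), List.map_map]
  rfl

theorem card_walkEdges (p : G.Path x y) : (walkEdges p.1).card = p.1.length := by
  rw [Finset.card_eq_sum_ones, sum_walkEdges]
  simp

theorem walkEdges_append [DecidableEq V] (p : G.Walk x y) (q : G.Walk y z) :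
    walkEdges (p.append q) = walkEdges p ∪ walkEdges q := by
  ext e
  simp [mem_walkEdges]

theorem walkEdges_map {W : Type*} [DecidableEq W] {H : SimpleGraph W} (f : G →g H)
    (p : G.Walk x y) : walkEdges (p.map f) = (walkEdges p).image f.mapEdgeSet := by
  ext e
  simp only [mem_walkEdges, SimpleGraph.Walk.edges_map, List.mem_map, Finset.mem_image,
    Subtype.ext_iff, SimpleGraph.Hom.mapEdgeSet_coe]
  exact ⟨fun ⟨s, hs, h⟩ => ⟨⟨s, p.edges_subset_edgeSet hs⟩, hs, h⟩, fun ⟨s, hs, h⟩ => ⟨s, hs, h⟩⟩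

/-- The passage time between two vertices of a graph whose edges carry nonnegative times: the
infimum over the self-avoiding paths of the total time of their edges. -/
noncomputable def passageDist (τ : G.edgeSet → ℝ≥0) (x y : V) : ℝ≥0 :=
  minSum (fun p : G.Path x y => walkEdges p.1) τ

theorem passageDist_le_sum (τ : G.edgeSet → ℝ≥0) (p : G.Walk x y) :
    passageDist τ x y ≤ ∑ e ∈ walkEdges p, τ e := by
  classical
  refine (minSum_le _ τ p.toPath).trans (Finset.sum_le_sum_of_subset fun e he => ?_)
  exact mem_walkEdges.2 (p.edges_bypass_subset_edges (mem_walkEdges.1 he))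

theorem passageDist_self (τ : G.edgeSet → ℝ≥0) (x : V) : passageDist τ x x = 0 :=
  le_antisymm ((passageDist_le_sum τ .nil).trans_eq (by simp [walkEdges])) zero_le

theorem passageDist_le_of_adj (τ : G.edgeSet → ℝ≥0) (h : G.Adj x y) :
    passageDist τ x y ≤ τ ⟨s(x, y), h⟩ := by
  refine (passageDist_le_sum τ h.toWalk).trans_eq ?_
  rw [Finset.sum_eq_single_of_mem ⟨s(x, y), h⟩ (by simp [mem_walkEdges])]
  exact fun e he hne => absurd (Subtype.ext (by simpa [mem_walkEdges] using he)) hne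

theorem passageDist_triangle (τ : G.edgeSet → ℝ≥0) (hxy : G.Reachable x y)
    (hyz : G.Reachable y z) : passageDist τ x z ≤ passageDist τ x y + passageDist τ y z := by
  classical
  have : Nonempty (G.Path x y) := ⟨hxy.some.toPath⟩
  have : Nonempty (G.Path y z) := ⟨hyz.some.toPath⟩
  refine NNReal.le_iInf_add_iInf fun p q => (passageDist_le_sum τ (p.1.append q.1)).trans ?_
  rw [walkEdges_append, ← Finset.sum_union_inter]
  exact le_self_add

theorem passageDist_map_le {W : Type*} {H : SimpleGraph W} {f : G →g H}
    (hf : Function.Injective f) (τ : H.edgeSet → ℝ≥0) (hxy : G.Reachable x y) :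
    passageDist τ (f x) (f y) ≤ passageDist (τ ∘ f.mapEdgeSet) x y := by
  classical
  have : Nonempty (G.Path x y) := ⟨hxy.some.toPath⟩
  refine le_ciInf fun p => (passageDist_le_sum τ (p.1.map f)).trans_eq ?_
  rw [walkEdges_map, Finset.sum_image (SimpleGraph.Hom.mapEdgeSet.injective f hf).injOn]
  rfl

instance [Countable V] : Countable (G.Path x y) :=
  Function.Injective.countable (f := fun p : G.Path x y => p.1.support) fun _ _ h =>
    Subtype.ext (SimpleGraph.Walk.ext_support h)

end PassageDist

section WalkCounting

variable {V α : Type*} {G : SimpleGraph V} {x y z : V}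

/-- The labels of the successive steps of a walk, where `f v` labels the neighbours of `v`. They are
used to count walks of a given length. -/
def stepLabels (f : ∀ v, G.neighborSet v → α) : ∀ {x y : V}, G.Walk x y → List α
  | _, _, .nil => []
  | x, _, .cons (v := v) h p => f x ⟨v, h⟩ :: stepLabels f p

theorem length_stepLabels (f : ∀ v, G.neighborSet v → α) (p : G.Walk x y) :
    (stepLabels f p).length = p.length := by
  induction p with
  | nil => rfl
  | cons h p ih => simp [stepLabels, ih]

theorem sigma_eq_of_stepLabels_eq {f : ∀ v, G.neighborSet v → α}
    (hf : ∀ v, Function.Injective (f v)) (p : G.Walk x y) (q : G.Walk x z)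
    (h : stepLabels f p = stepLabels f q) : (⟨y, p⟩ : Σ v, G.Walk x v) = ⟨z, q⟩ := by
  induction p with
  | nil => cases q with
    | nil => rfl
    | cons => simp [stepLabels] at h
  | cons hu p ih => cases q with
    | nil => simp [stepLabels] at h
    | cons hv q =>
      rw [stepLabels, stepLabels, List.cons.injEq] at h
      obtain rfl := Subtype.mk.inj (hf _ h.1)
      cases ih q h.2
      rfl

theorem card_path_card_walkEdges_eq_le [Fintype α] {f : ∀ v, G.neighborSet v → α}
    (hf : ∀ v, Function.Injective (f v)) (x : V) (n : ℕ) :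
    ENat.card {q : Σ y, G.Path x y // (walkEdges q.2.1).card = n} ≤
      (Fintype.card α : ℕ∞) ^ n := by
  have hcard : ENat.card (List.Vector α n) = (Fintype.card α : ℕ∞) ^ n := by simp
  rw [← hcard]
  refine ENat.card_le_card_of_injective (f := fun q => ⟨stepLabels f q.1.2.1,
    (length_stepLabels f _).trans ((card_walkEdges q.1.2).symm.trans q.2)⟩) ?_
  rintro ⟨⟨y, p⟩, hp⟩ ⟨⟨z, q⟩, hq⟩ h
  obtain ⟨rfl, hpq⟩ := Sigma.mk.inj (sigma_eq_of_stepLabels_eq hf p.1 q.1 (Subtype.mk.inj h))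
  obtain rfl := Subtype.ext (eq_of_heq hpq)
  rfl

end WalkCounting

section Lattice

variable {d : ℕ} {x y : Fin d → ℤ}

theorem abs_sub_le_one_of_adj (h : (lattice d).Adj x y) (i : Fin d) : |x i - y i| ≤ 1 :=
  (Finset.single_le_sum (fun i _ => abs_nonneg (x i - y i)) (Finset.mem_univ i)).trans_eq h

theorem abs_sub_le_length (p : (lattice d).Walk x y) (i : Fin d) : |x i - y i| ≤ p.length := by
  induction p with
  | nil => simp
  | cons h p ih =>
    rw [SimpleGraph.Walk.length_cons, Nat.cast_succ, add_comm]
    exact (abs_sub_le _ _ _).trans (add_le_add (abs_sub_le_one_of_adj h i) ih)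

/-- The displacement from a vertex of the lattice to a neighbour, an element of `{-1, 0, 1}^d`. It
labels the steps of a walk. -/
def displacement (x : Fin d → ℤ) (y : (lattice d).neighborSet x) :
    Finset.Icc (-1 : Fin d → ℤ) 1 :=
  have h (i : Fin d) : |y.1 i - x i| ≤ 1 := abs_sub_le_one_of_adj y.2.symm i
  ⟨y.1 - x, Finset.mem_Icc.2 ⟨fun i => (abs_le.1 (h i)).1, fun i => (abs_le.1 (h i)).2⟩⟩

theorem displacement_injective (x : Fin d → ℤ) : Function.Injective (displacement x) :=
  fun _ _ h => Subtype.ext (sub_left_injective (Subtype.mk.inj h))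

/-- Translation by `v`, as an endomorphism of the lattice. -/
def translate (v : Fin d → ℤ) : lattice d →g lattice d where
  toFun x := x + v
  map_rel' {a b} h := by
    change ∑ i, |(a + v) i - (b + v) i| = 1
    simpa using! h

theorem translate_injective (v : Fin d → ℤ) : Function.Injective (translate v) :=
  add_left_injective v

theorem axisPoint_zero : axisPoint d 0 = 0 := by
  funext i
  simp [axisPoint]

theorem translate_axisPoint (m n : ℕ) :
    translate (axisPoint d m) (axisPoint d n) = axisPoint d (m + n) := by
  funext i
  change axisPoint d n i + axisPoint d m i = axisPoint d (m + n) i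
  by_cases hi : i.val = 0 <;> simp [axisPoint, hi, add_comm]

theorem adj_axisPoint (hd : 0 < d) (n : ℕ) :
    (lattice d).Adj (axisPoint d n) (axisPoint d (n + 1)) := by
  change ∑ i, |axisPoint d n i - axisPoint d (n + 1) i| = 1
  rw [Finset.sum_eq_single_of_mem ⟨0, hd⟩ (Finset.mem_univ _) fun i _ hi => by
    simp [axisPoint, show i.val ≠ 0 from fun h => hi (Fin.ext h)]]
  simp [axisPoint]

theorem reachable_axisPoint (hd : 0 < d) (n : ℕ) : (lattice d).Reachable 0 (axisPoint d n) := by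
  induction n with
  | zero => rw [axisPoint_zero]
  | succ n ih => exact ih.trans (adj_axisPoint hd n).reachable

theorem le_length_of_walk_axisPoint (hd : 0 < d) {n : ℕ}
    (p : (lattice d).Walk 0 (axisPoint d n)) : n ≤ p.length := by
  simpa [axisPoint] using abs_sub_le_length p ⟨0, hd⟩

/-- The edge joining `(n, 0, …, 0)` to `(n + 1, 0, …, 0)`. -/
def axisEdge (hd : 0 < d) (n : ℕ) : Edge d :=
  ⟨s(axisPoint d n, axisPoint d (n + 1)), adj_axisPoint hd n⟩

theorem axisEdge_injective (hd : 0 < d) : Function.Injective (axisEdge hd) := by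
  have hinj : Function.Injective (axisPoint d) := fun m n h => by
    simpa [axisPoint] using congrFun h ⟨0, hd⟩
  intro m n h
  obtain ⟨h, -⟩ | ⟨h, h'⟩ := Sym2.eq_iff.1 (Subtype.mk.inj h)
  · exact hinj h
  · have := hinj h
    have := hinj h'
    omega

theorem passageDist_axisPoint_add_le (hd : 0 < d) (τ : Edge d → ℝ≥0) (m n : ℕ) :
    passageDist τ 0 (axisPoint d (m + n)) ≤ passageDist τ 0 (axisPoint d m) +
      passageDist (τ ∘ (translate (axisPoint d m)).mapEdgeSet) 0 (axisPoint d n) := by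
  have hreach := (reachable_axisPoint hd m).symm.trans (reachable_axisPoint hd (m + n))
  refine (passageDist_triangle τ (reachable_axisPoint hd m) hreach).trans ?_
  have hmap := passageDist_map_le (translate_injective (axisPoint d m)) τ
    (reachable_axisPoint hd n)
  rw [← axisPoint_zero, translate_axisPoint, translate_axisPoint, axisPoint_zero] at hmap
  simpa using! hmap

theorem monotone_passageDist_add_sum_axisEdge (hd : 0 < d) (τ : Edge d → ℝ≥0) :
    Monotone fun n => (passageDist τ 0 (axisPoint d n) : ℝ) +
      ∑ j ∈ Finset.range n, (τ (axisEdge hd j) : ℝ) := by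
  refine monotone_nat_of_le_succ fun n => ?_
  have hadj := (adj_axisPoint hd n).symm
  have hedge : passageDist τ (axisPoint d (n + 1)) (axisPoint d n) ≤ τ (axisEdge hd n) :=
    (passageDist_le_of_adj τ hadj).trans_eq (congrArg τ (Subtype.ext Sym2.eq_swap))
  have htri := (passageDist_triangle τ (reachable_axisPoint hd (n + 1)) hadj.reachable).trans
    (add_le_add_right hedge _)
  rw [Finset.sum_range_succ]
  have : (passageDist τ 0 (axisPoint d n) : ℝ) ≤
    passageDist τ 0 (axisPoint d (n + 1)) + τ (axisEdge hd n) := mod_cast htri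
  linarith

theorem minPassageTime_coe (τ : Edge d → ℝ≥0) (n : ℕ) :
    minPassageTime (fun e => (τ e : ℝ)) n = passageDist τ 0 (axisPoint d n) := by
  rw [passageDist, minSum, NNReal.coe_iInf]
  refine iInf_congr fun p => ?_
  rw [sum_walkEdges p, passageTime, NNReal.coe_list_sum, List.map_map]
  rfl

end Lattice

section TimeConstant

variable {d : ℕ} {G : Measure ℝ≥0}

/-- The law of independent passage times with common law `G`. -/
noncomputable abbrev configLaw (d : ℕ) (G : Measure ℝ≥0) : Measure (Edge d → ℝ≥0) :=
  Measure.infinitePi fun _ => G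

@[fun_prop]
theorem measurable_passageDist (x y : Fin d → ℤ) :
    Measurable fun τ : Edge d → ℝ≥0 => passageDist τ x y :=
  measurable_minSum _

theorem integral_passageDist (ν : Measure (Edge d → ℝ≥0)) (x y : Fin d → ℤ) :
    ∫ τ, (passageDist τ x y : ℝ) ∂ν = (∫⁻ τ, passageDist τ x y ∂ν).toReal :=
  integral_toReal (f := fun τ => (passageDist τ x y : ℝ≥0∞))
    (Measurable.aemeasurable (by fun_prop)) (by simp)

variable [IsProbabilityMeasure G]

theorem memLp_passageDist {p : ℝ≥0∞} (hG : MemLp (fun t : ℝ≥0 => (t : ℝ)) p G)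
    {x y : Fin d → ℤ} (hxy : (lattice d).Reachable x y) :
    MemLp (fun τ => (passageDist τ x y : ℝ)) p (configLaw d G) :=
  have : Nonempty ((lattice d).Path x y) := ⟨hxy.some.toPath⟩
  memLp_minSum (fun _ => hG) _

theorem exists_lintegral_excess_path_le (d : ℕ) (hG : G {0} = 0) :
    ∃ r w : ℝ≥0, ∀ y, ∫⁻ τ, excess (fun p : (lattice d).Path 0 y => walkEdges p.1) r τ
      ∂configLaw d G ≤ w := by
  let A (q : Σ y, (lattice d).Path 0 y) : Finset (Edge d) := walkEdges q.2.1
  obtain ⟨r, hr⟩ := exists_lintegral_excess_ne_top (A := A) hG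
    (card_path_card_walkEdges_eq_le displacement_injective 0)
  refine ⟨r, (∫⁻ τ, excess A r τ ∂configLaw d G).toNNReal, fun y => ?_⟩
  rw [ENNReal.coe_toNNReal hr]
  exact lintegral_mono fun τ => excess_comp_le (A := A) (Sigma.mk y)

theorem measurePreserving_comp_translate (v : Fin d → ℤ) :
    MeasurePreserving (fun τ : Edge d → ℝ≥0 => τ ∘ (translate v).mapEdgeSet) (configLaw d G)
      (configLaw d G) :=
  ⟨by unfold Function.comp; fun_prop, Measure.map_infinitePi_infinitePi_of_inj
    (P := fun _ : Edge d => G) (SimpleGraph.Hom.mapEdgeSet.injective _ (translate_injective v))⟩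

theorem lintegral_passageDist_axisPoint_add_le (hd : 0 < d) (m n : ℕ) :
    ∫⁻ τ, passageDist τ 0 (axisPoint d (m + n)) ∂configLaw d G ≤
      ∫⁻ τ, passageDist τ 0 (axisPoint d m) ∂configLaw d G +
        ∫⁻ τ, passageDist τ 0 (axisPoint d n) ∂configLaw d G := by
  have hshift := measurePreserving_comp_translate (G := G) (axisPoint d m)
  rw [← hshift.lintegral_comp (f := fun τ => (passageDist τ 0 (axisPoint d n) : ℝ≥0∞))
    (by fun_prop), ← lintegral_add_left (by fun_prop)]
  exact lintegral_mono fun τ => ENNReal.coe_le_coe.2 (passageDist_axisPoint_add_le hd τ m n)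

theorem lintegral_passageDist_axisPoint_le (hd : 0 < d) (n : ℕ) :
    ∫⁻ τ, passageDist τ 0 (axisPoint d n) ∂configLaw d G ≤
      n * ∫⁻ τ, passageDist τ 0 (axisPoint d 1) ∂configLaw d G := by
  induction n with
  | zero => simp [axisPoint_zero, passageDist_self]
  | succ n ih =>
    rw [Nat.cast_succ, add_one_mul]
    exact (lintegral_passageDist_axisPoint_add_le hd n 1).trans (by gcongr)

theorem lintegral_passageDist_ne_top (hG : MemLp (fun t : ℝ≥0 => (t : ℝ)) 1 G)
    {x y : Fin d → ℤ} (hxy : (lattice d).Reachable x y) :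
    ∫⁻ τ, passageDist τ x y ∂configLaw d G ≠ ∞ :=
  have : Nonempty ((lattice d).Path x y) := ⟨hxy.some.toPath⟩
  lintegral_minSum_ne_top (fun _ => hG) _

theorem subadditive_integral_passageDist (hd : 0 < d)
    (hG : MemLp (fun t : ℝ≥0 => (t : ℝ)) 1 G) :
    Subadditive fun n => ∫ τ, (passageDist τ 0 (axisPoint d n) : ℝ) ∂configLaw d G := by
  intro m n
  have hfin (n) := lintegral_passageDist_ne_top hG (reachable_axisPoint hd n)
  simp only [integral_passageDist]
  rw [← ENNReal.toReal_add (hfin m) (hfin n)]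
  exact ENNReal.toReal_mono (ENNReal.add_ne_top.2 ⟨hfin m, hfin n⟩)
    (lintegral_passageDist_axisPoint_add_le hd m n)

theorem exists_evariance_passageDist_le (hd : 0 < d) (hG : G {0} = 0)
    (hG2 : MemLp (fun t : ℝ≥0 => (t : ℝ)) 2 G) :
    ∃ C : ℝ≥0∞, C ≠ ∞ ∧ ∀ n : ℕ,
      eVar[fun τ => (passageDist τ 0 (axisPoint d n) : ℝ); configLaw d G] ≤ C * n := by
  obtain ⟨r, w, hw⟩ := exists_lintegral_excess_path_le d hG
  have hM : ∫⁻ t, (t : ℝ≥0∞) ^ 2 ∂G ≠ ∞ := by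
    simpa [enorm_eq_nnnorm] using! hG2.integrable_sq.lintegral_lt_top.ne
  lift ∫⁻ t, (t : ℝ≥0∞) ^ 2 ∂G to ℝ≥0 using hM with M hM'
  have hL := lintegral_passageDist_ne_top (hG2.mono_exponent one_le_two) (reachable_axisPoint hd 1)
  set L := ∫⁻ τ, passageDist τ 0 (axisPoint d 1) ∂configLaw d G
  refine ⟨M * (r * L + w), by finiteness, fun n => ?_⟩
  obtain rfl | hn := n.eq_zero_or_pos
  · simp [axisPoint_zero, passageDist_self, evariance]
  have : Nonempty ((lattice d).Path 0 (axisPoint d n)) := ⟨(reachable_axisPoint hd n).some.toPath⟩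
  calc eVar[fun τ => (passageDist τ 0 (axisPoint d n) : ℝ); configLaw d G]
      ≤ M * (r * ∫⁻ τ, passageDist τ 0 (axisPoint d n) ∂configLaw d G + ∫⁻ τ, excess
          (fun p : (lattice d).Path 0 (axisPoint d n) => walkEdges p.1) r τ ∂configLaw d G) :=
        evariance_minSum_le (fun _ => hG2) fun _ => hM'.ge
    _ ≤ M * (r * (n * L) + n * w) := by
        gcongr
        · exact lintegral_passageDist_axisPoint_le hd n
        · exact (hw _).trans (le_mul_of_one_le_left' (mod_cast hn))
    _ = M * (r * L + w) * n := by ring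

theorem natCast_le_mul_integral_passageDist_add (hd : 0 < d)
    (hG : MemLp (fun t : ℝ≥0 => (t : ℝ)) 1 G) {r w : ℝ≥0} {n : ℕ}
    (hw : ∫⁻ τ, excess (fun p : (lattice d).Path 0 (axisPoint d n) => walkEdges p.1) r τ
      ∂configLaw d G ≤ w) :
    (n : ℝ) ≤ r * ∫ τ, (passageDist τ 0 (axisPoint d n) : ℝ) ∂configLaw d G + w := by
  have : Nonempty ((lattice d).Path 0 (axisPoint d n)) := ⟨(reachable_axisPoint hd n).some.toPath⟩
  have hfin := lintegral_passageDist_ne_top hG (reachable_axisPoint hd n)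
  have hle : (n : ℝ≥0∞) ≤ r * ∫⁻ τ, passageDist τ 0 (axisPoint d n) ∂configLaw d G + w := by
    calc (n : ℝ≥0∞) = ∫⁻ _, n ∂configLaw d G := by simp
      _ ≤ ∫⁻ τ, (r * passageDist τ 0 (axisPoint d n) + excess
            (fun p : (lattice d).Path 0 (axisPoint d n) => walkEdges p.1) r τ) ∂configLaw d G :=
          lintegral_mono fun τ => natCast_le_mul_minSum_add_excess fun p =>
            (le_length_of_walk_axisPoint hd p.1).trans_eq (card_walkEdges p).symm
      _ ≤ _ := by
          rw [lintegral_add_left (by fun_prop), lintegral_const_mul _ (by fun_prop)]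
          gcongr
  rw [integral_passageDist]
  simpa [ENNReal.toReal_add (ENNReal.mul_ne_top ENNReal.coe_ne_top hfin)] using
    ENNReal.toReal_mono (by finiteness) hle

theorem exists_tendsto_integral_passageDist_div (hd : 0 < d) (hG : G {0} = 0)
    (hG1 : MemLp (fun t : ℝ≥0 => (t : ℝ)) 1 G) :
    ∃ a : ℝ, 0 < a ∧ Tendsto
      (fun n : ℕ => (∫ τ, (passageDist τ 0 (axisPoint d n) : ℝ) ∂configLaw d G) / n)
      atTop (𝓝 a) := by
  obtain ⟨r, w, hw⟩ := exists_lintegral_excess_path_le d hG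
  have hsub := subadditive_integral_passageDist hd hG1
  have hlim := hsub.tendsto_lim ⟨0, Set.forall_mem_range.2 fun n => by positivity⟩
  refine ⟨hsub.lim, ?_, hlim⟩
  have hone : 1 ≤ r * hsub.lim + w * 0 := by
    refine ge_of_tendsto ((hlim.const_mul (r : ℝ)).add
      (tendsto_inv_atTop_nhds_zero_nat.const_mul (w : ℝ))) ?_
    filter_upwards [eventually_gt_atTop 0] with n hn
    have := natCast_le_mul_integral_passageDist_add hd hG1 (hw (axisPoint d n))
    field_simp
    exact this
  by_contra! hle
  linarith [mul_nonpos_of_nonneg_of_nonpos r.coe_nonneg hle]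

theorem ae_tendsto_sum_axisEdge_div (hd : 0 < d) (hG : MemLp (fun t : ℝ≥0 => (t : ℝ)) 1 G) :
    ∀ᵐ τ ∂configLaw d G, Tendsto
      (fun n : ℕ => (∑ j ∈ Finset.range n, (τ (axisEdge hd j) : ℝ)) / n) atTop
      (𝓝 (∫ τ, (τ (axisEdge hd 0) : ℝ) ∂configLaw d G)) := by
  have hmp (e : Edge d) := measurePreserving_eval_infinitePi (fun _ : Edge d => G) e
  have hcoe : Measurable fun t : ℝ≥0 => (t : ℝ) := by fun_prop
  have hind : iIndepFun (fun j (τ : Edge d → ℝ≥0) => (τ (axisEdge hd j) : ℝ)) (configLaw d G) :=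
    (iIndepFun_infinitePi (P := fun _ : Edge d => G) fun _ => hcoe).precomp (axisEdge_injective hd)
  refine strong_law_ae_real _
    ((hG.comp_measurePreserving (hmp _)).integrable le_rfl)
    (fun i j hij => hind.indepFun hij) fun j => ?_
  have hid : IdentDistrib (fun τ : Edge d → ℝ≥0 => τ (axisEdge hd j)) (fun τ => τ (axisEdge hd 0))
      (configLaw d G) (configLaw d G) :=
    ⟨(hmp _).aemeasurable, (hmp _).aemeasurable, (hmp _).map_eq.trans (hmp _).map_eq.symm⟩
  exact hid.comp hcoe

theorem exists_timeConstant (hd : 0 < d) (hG : G {0} = 0)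
    (hG2 : MemLp (fun t : ℝ≥0 => (t : ℝ)) 2 G) :
    ∃ a : ℝ, 0 < a ∧
      (∀ᵐ τ ∂configLaw d G,
        Tendsto (fun n : ℕ => (passageDist τ 0 (axisPoint d n) : ℝ) / n) atTop (𝓝 a)) ∧
      Tendsto (fun n : ℕ => eLpNorm
        (fun τ => (passageDist τ 0 (axisPoint d n) : ℝ) / n - a) 2 (configLaw d G))
        atTop (𝓝 0) := by
  have hG1 := hG2.mono_exponent one_le_two
  have hmeas (n : ℕ) : AEMeasurable (fun τ => (passageDist τ 0 (axisPoint d n) : ℝ))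
      (configLaw d G) := Measurable.aemeasurable (by fun_prop)
  obtain ⟨a, ha, hmean⟩ := exists_tendsto_integral_passageDist_div hd hG hG1
  obtain ⟨C, hC, hvar⟩ := exists_evariance_passageDist_le hd hG hG2
  exact ⟨a, ha,
    ae_tendsto_div_of_evariance_le hmeas hmean hC hvar (monotone_passageDist_add_sum_axisEdge hd)
      (ae_tendsto_sum_axisEdge_div hd hG1),
    tendsto_eLpNorm_div_sub_of_evariance_le hmeas hmean hC hvar⟩

end TimeConstant

section Transfer

variable {d : ℕ} {F : Measure ℝ} {Ω : Type*} [MeasurableSpace Ω] {P : Measure Ω}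
  {t : Edge d → Ω → ℝ}

theorem map_Iic_zero_of_smallTimesUnlikely (hs : SmallTimesUnlikely P t) {e : Edge d}
    (ht : Measurable (t e)) : P.map (t e) (Set.Iic 0) = 0 := by
  rw [Measure.map_apply ht measurableSet_Iic]
  refine le_antisymm (ge_of_tendsto hs ?_) zero_le
  filter_upwards [self_mem_nhdsWithin] with ε hε
  refine le_trans (measure_mono fun ω hω => ?_) (le_iSup (fun e => P {ω | t e ω < ε}) e)
  exact lt_of_le_of_lt (Set.mem_Iic.1 hω) (Set.mem_Ioi.1 hε)

theorem memLp_id_map_of_boundedSecondMoment (hb : BoundedSecondMoment P t) {e : Edge d}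
    (ht : Measurable (t e)) : MemLp (fun x : ℝ => x) 2 (P.map (t e)) := by
  rw [memLp_map_measure_iff (by fun_prop) ht.aemeasurable,
    memLp_two_iff_integrable_sq (Measurable.aestronglyMeasurable (by fun_prop))]
  refine ⟨Measurable.aestronglyMeasurable (by fun_prop), ?_⟩
  rw [hasFiniteIntegral_iff_ofReal (ae_of_all _ fun ω => sq_nonneg _)]
  exact (le_iSup (fun e => ∫⁻ ω, ENNReal.ofReal (t e ω ^ 2) ∂P) e).trans_lt hb

theorem map_toNNReal_singleton_zero (hF : F (Set.Iic 0) = 0) : F.map Real.toNNReal {0} = 0 := by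
  rw [Measure.map_apply measurable_real_toNNReal (measurableSet_singleton 0)]
  exact measure_mono_null (fun x hx => Real.toNNReal_eq_zero.1 hx) hF

theorem memLp_coe_map_toNNReal {p : ℝ≥0∞} (hF : MemLp (fun x : ℝ => x) p F) :
    MemLp (fun s : ℝ≥0 => (s : ℝ)) p (F.map Real.toNNReal) := by
  rw [memLp_map_measure_iff (by fun_prop) measurable_real_toNNReal.aemeasurable]
  exact hF.pos_part

theorem measurePreserving_toNNReal [IsProbabilityMeasure P] (ht : ∀ e, Measurable (t e))
    (hind : iIndepFun t P) (hF : ∀ e, P.map (t e) = F) :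
    MeasurePreserving (fun ω e => (t e ω).toNNReal) P (configLaw d (F.map Real.toNNReal)) := by
  have hm (e) : Measurable fun ω => (t e ω).toNNReal := (ht e).real_toNNReal
  refine ⟨measurable_pi_lambda _ hm, ?_⟩
  have hind' := hind.comp (fun _ => Real.toNNReal) fun _ => measurable_real_toNNReal
  refine (hind'.map_fun_eq_infinitePi_map hm).trans ?_
  congr 1 with e : 1
  rw [← hF e, Measure.map_map measurable_real_toNNReal (ht e)]
  rfl

theorem ae_passageDist_toNNReal_eq (ht : ∀ e, Measurable (t e))
    (h0 : ∀ e, P.map (t e) (Set.Iic 0) = 0) :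
    ∀ᵐ ω ∂P, ∀ n, (passageDist (fun e => (t e ω).toNNReal) 0 (axisPoint d n) : ℝ) =
      minPassageTime (fun e => t e ω) n := by
  have : Countable (Edge d) := by
    have : Countable (Sym2 (Fin d → ℤ)) := inferInstanceAs (Countable (Quot _))
    exact Subtype.countable
  have hpos : ∀ᵐ ω ∂P, ∀ e, 0 < t e ω := ae_all_iff.2 fun e =>
    (ae_of_ae_map (ht e).aemeasurable (measure_eq_zero_iff_ae_notMem.1 (h0 e))).mono
      fun ω hω => not_le.1 hω
  filter_upwards [hpos] with ω hω n
  rw [← minPassageTime_coe]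
  simp only [Real.coe_toNNReal _ (hω _).le]

end Transfer

end FirstPassage

theorem corollary1_general (d : ℕ) (hd : 0 < d) (F : Measure ℝ) [IsProbabilityMeasure F] :
    ∃ μF : ℝ, 0 < μF ∧
      ∀ (Ω : Type*) [MeasurableSpace Ω] (P : Measure Ω) [IsProbabilityMeasure P]
        (t : FirstPassage.Edge d → Ω → ℝ),
        (∀ e, Measurable (t e)) → iIndepFun t P → (∀ e, P.map (t e) = F) →
        FirstPassage.SmallTimesUnlikely P t → FirstPassage.BoundedSecondMoment P t →
        (∀ᵐ ω ∂P, Tendsto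
          (fun n : ℕ => FirstPassage.minPassageTime (fun e => t e ω) n / (n : ℝ))
          atTop (𝓝 μF)) ∧
        (∀ n : ℕ, MemLp (fun ω => FirstPassage.minPassageTime (fun e => t e ω) n) 2 P) ∧
        Tendsto
          (fun n : ℕ => eLpNorm
            (fun ω => FirstPassage.minPassageTime (fun e => t e ω) n / (n : ℝ) - μF) 2 P)
          atTop (𝓝 0) := by
  by_cases hF : F (Set.Iic 0) = 0 ∧ MemLp (fun x : ℝ => x) 2 F
  swap
  · refine ⟨1, one_pos, fun Ω _ P _ t ht _ hlaw hs hb => absurd ?_ hF⟩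
    rw [← hlaw (FirstPassage.axisEdge hd 0)]
    exact ⟨FirstPassage.map_Iic_zero_of_smallTimesUnlikely hs (ht _),
      FirstPassage.memLp_id_map_of_boundedSecondMoment hb (ht _)⟩
  have := Measure.isProbabilityMeasure_map (μ := F) measurable_real_toNNReal.aemeasurable
  have hG2 := FirstPassage.memLp_coe_map_toNNReal hF.2
  obtain ⟨a, ha, hae, hL2⟩ := FirstPassage.exists_timeConstant hd
    (FirstPassage.map_toNNReal_singleton_zero hF.1) hG2
  refine ⟨a, ha, fun Ω _ P _ t ht hind hlaw _ _ => ?_⟩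
  have hmp := FirstPassage.measurePreserving_toNNReal ht hind hlaw
  have heq := FirstPassage.ae_passageDist_toNNReal_eq ht fun e => (hlaw e).symm ▸ hF.1
  refine ⟨?_, fun n => ?_, hL2.congr fun n => ?_⟩
  · filter_upwards [hmp.quasiMeasurePreserving.ae hae, heq] with ω hω h
    simpa only [h] using hω
  · have hmem := FirstPassage.memLp_passageDist hG2 (FirstPassage.reachable_axisPoint hd n)
    exact (hmem.comp_measurePreserving hmp).ae_eq (heq.mono fun ω h => h n)
  · rw [← eLpNorm_comp_measurePreserving (Measurable.aestronglyMeasurable (by fun_prop)) hmp]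
    exact eLpNorm_congr_ae (heq.mono fun ω h => by simp only [Function.comp, h n])

theorem corollary1 (d : ℕ) (hd : 2 ≤ d) (F : Measure ℝ) [IsProbabilityMeasure F] :
    ∃ μF : ℝ, 0 < μF ∧
      ∀ (Ω : Type*) [MeasurableSpace Ω] (P : Measure Ω) [IsProbabilityMeasure P]
        (t : FirstPassage.Edge d → Ω → ℝ),
        (∀ e, Measurable (t e)) → iIndepFun t P → (∀ e, P.map (t e) = F) →
        FirstPassage.SmallTimesUnlikely P t → FirstPassage.BoundedSecondMoment P t →
        (∀ᵐ ω ∂P, Tendsto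
          (fun n : ℕ => FirstPassage.minPassageTime (fun e => t e ω) n / (n : ℝ))
          atTop (𝓝 μF)) ∧
        (∀ n : ℕ, MemLp (fun ω => FirstPassage.minPassageTime (fun e => t e ω) n) 2 P) ∧
        Tendsto
          (fun n : ℕ => eLpNorm
            (fun ω => FirstPassage.minPassageTime (fun e => t e ω) n / (n : ℝ) - μF) 2 P)
          atTop (𝓝 0) :=
  corollary1_general d (by omega) F
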